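/- Let $n,t$ be natural numbers with $t\ge 1$ and let $X\in\mathcal S^n$ be a real symmetric $n\times n$ matrix. Let $\rho_{(X,X)}=\sum_{i,j}X_{ij}\,e_ie_i^*\otimes e_je_j^*+\sum_{i\ne j}X_{ij}\,e_ie_j^*\otimes e_ie_j^*$, acting on $\mathbb C^n\otimes\mathbb C^n$, and let $\rho_{(X,X)}^{T_B}$ be its partial transpose with respect to the second tensor factor, $(\rho^{T_B})_{ih,jk}=\rho_{ik,jh}$. Then $$\rho_{(X,X)}^{T_B}\in\widetilde{\mathrm{DPS}}^{(t)}_n\iff X\in(\mathcal K^{(t-1)}_n)^*.$$ Here $\widetilde{\mathrm{DPS}}^{(t)}_n$ is the set of Hermitian matrices $\rho$ on $\mathbb C^n\otimes\mathbb C^n$ for which there is a Hermitian matrix $R$ on $(\mathbb C^n)^{\otimes(t+1)}$ (register $0$ called A, registers $1,\dots,t$ called B-registers) such that 1. $R$ is Bose symmetric: $R\,(e_{i_0}\otimes\cdots\otimes e_{i_t})=R\,(e_{i_{\sigma(0)}}\otimes\cdots\otimes e_{i_{\sigma(t)}})$ for every permutation $\sigma$ of the $t+1$ registers and all indices $i_0,\dots,i_t$;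 2. $R^{T_{B[s]}}\succeq0$ for all $s=0,1,\dots,\lfloor (t+1)/2\rfloor$, where $T_{B[s]}$ is the partial transpose with respect to the first $s$ B-registers; 3. $\rho=\mathrm{Tr}_{B[2:t]}(R)$, the partial trace over the last $t-1$ B-registers. For $k\ge0$, $\mathcal K^{(k)}_n$ is the set of $A\in\mathcal S^n$ for which the polynomial $\big(\sum_{i}x_i^2\big)^{k}\sum_{i,j}A_{ij}x_i^2x_j^2\in\mathbb R[x_1,\dots,x_n]$ is a sum of squares of real polynomials, and $(\mathcal K^{(k)}_n)^*=\{X\in\mathcal S^n:\mathrm{Tr}(X^TA)\ge0\ \text{for all }A\in\mathcal K^{(k)}_n\}$. -/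

import Mathlib

open scoped ComplexOrder

/-! ### Bipartite matrices -/

/-- The matrix `ρ_(X,Y)` acting on `ℂⁿ ⊗ ℂⁿ`, for `X ∈ ℝⁿˣⁿ` and `Y ∈ Hermⁿ` with the same diagonal:
the entry at position `(ij, ij)` is `X i j`, the entry at position `(ii, kk)` with `i ≠ k` is
`Y i k`, and all other entries vanish, i.e.
`ρ_(X,Y) = ∑ i j, X i j • eᵢeᵢ* ⊗ eⱼeⱼ* + ∑ i ≠ k, Y i k • eᵢeₖ* ⊗ eᵢeₖ*`. -/
def rhoPair {n : ℕ} (X : Matrix (Fin n) (Fin n) ℝ) (Y : Matrix (Fin n) (Fin n) ℂ) :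
    Matrix (Fin n × Fin n) (Fin n × Fin n) ℂ :=
  Matrix.of fun p q =>
    if p = q then (X p.1 p.2 : ℂ)
    else if p.1 = p.2 ∧ q.1 = q.2 then Y p.1 q.1
    else 0

/-- The partial transpose `ρ^{T_B}` with respect to the B-register:
`(ρ^{T_B})_{ih,jk} = ρ_{ik,jh}`. -/
def partialTransposeB {n : ℕ} (ρ : Matrix (Fin n × Fin n) (Fin n × Fin n) ℂ) :
    Matrix (Fin n × Fin n) (Fin n × Fin n) ℂ :=
  Matrix.of fun p q => ρ (p.1, q.2) (q.1, p.2)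

/-! ### Matrices on several registers

A matrix acting on `(ℂⁿ)^{⊗ m}` has its rows and columns indexed by `Fin m → Fin n`. For
`m = t + 1`, register `0` is the A-register and registers `1, …, t` are the B-registers. -/

/-- Bose symmetric Hermitian matrices on `(ℂⁿ)^{⊗ m}`: Hermitian matrices `R` with
`R (e_{i_1} ⊗ ⋯ ⊗ e_{i_m}) = R (e_{i_{σ(1)}} ⊗ ⋯ ⊗ e_{i_{σ(m)}})` for all permutations `σ` of the
registers. -/
def IsBoseSymmetric {n m : ℕ} (R : Matrix (Fin m → Fin n) (Fin m → Fin n) ℂ) : Prop :=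
  R.IsHermitian ∧
    ∀ (σ : Equiv.Perm (Fin m)) (i j : Fin m → Fin n), R i (fun r => j (σ r)) = R i j

/-- The partial transpose `R^{T_{B[s]}}` with respect to the first `s` B-registers (registers
`1, …, s`): in these registers the row and the column index are exchanged. -/
def partialTransposeFirst {n t : ℕ} (s : ℕ)
    (R : Matrix (Fin (t + 1) → Fin n) (Fin (t + 1) → Fin n) ℂ) :
    Matrix (Fin (t + 1) → Fin n) (Fin (t + 1) → Fin n) ℂ :=
  Matrix.of fun i j =>
    R (fun r => if 1 ≤ r.val ∧ r.val ≤ s then j r else i r)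
      (fun r => if 1 ≤ r.val ∧ r.val ≤ s then i r else j r)

/-- The concatenated index `a b k₁ … k_{t-1}` of length `t + 1` (for `t ≥ 1`). -/
def concatIndex {n t : ℕ} (a b : Fin n) (k : Fin (t - 1) → Fin n) : Fin (t + 1) → Fin n :=
  fun r =>
    if r.val = 0 then a
    else if r.val = 1 then b
    else if h : r.val - 2 < t - 1 then k ⟨r.val - 2, h⟩
    else a -- never reached: `2 ≤ r.val ≤ t` here

/-- The partial trace `Tr_{B[2:t]}`: the last `t - 1` B-registers are traced out (for `t ≥ 1`). -/
def partialTraceLast {n t : ℕ} (R : Matrix (Fin (t + 1) → Fin n) (Fin (t + 1) → Fin n) ℂ) :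
    Matrix (Fin n × Fin n) (Fin n × Fin n) ℂ :=
  Matrix.of fun p q =>
    ∑ k : Fin (t - 1) → Fin n, R (concatIndex p.1 p.2 k) (concatIndex q.1 q.2 k)

/-- The Bose symmetric DPS relaxation of order `t ≥ 1`: Hermitian matrices `ρ` on `ℂⁿ ⊗ ℂⁿ` that
have a Bose symmetric extension `R` to `(ℂⁿ)^{⊗ (t+1)}` with `R^{T_{B[s]}} ⪰ 0` for
`0 ≤ s ≤ ⌊(t+1)/2⌋` and `Tr_{B[2:t]} R = ρ`. -/
def DPSBose (n t : ℕ) : Set (Matrix (Fin n × Fin n) (Fin n × Fin n) ℂ) :=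
  {ρ | ρ.IsHermitian ∧
    ∃ R : Matrix (Fin (t + 1) → Fin n) (Fin (t + 1) → Fin n) ℂ,
      IsBoseSymmetric R ∧
      (∀ s : ℕ, s ≤ (t + 1) / 2 → (partialTransposeFirst s R).PosSemidef) ∧
      ρ = partialTraceLast R}

/-! ### The cones `K^(t)_n` and their duals -/

/-- The polynomial `f_A = ∑ i j, A i j xᵢ² xⱼ²`. -/
noncomputable def quarticForm {n : ℕ} (A : Matrix (Fin n) (Fin n) ℝ) : MvPolynomial (Fin n) ℝ :=
  ∑ i, ∑ j, MvPolynomial.C (A i j) * MvPolynomial.X i ^ 2 * MvPolynomial.X j ^ 2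

/-- The cone `K^(t)_n` of real symmetric matrices `A` for which `(∑ i, xᵢ²)^t f_A` is a sum of
squares of real polynomials. -/
def coneK (n t : ℕ) : Set (Matrix (Fin n) (Fin n) ℝ) :=
  {A | A.IsSymm ∧
    IsSumSq ((∑ i : Fin n, (MvPolynomial.X i : MvPolynomial (Fin n) ℝ) ^ 2) ^ t * quarticForm A)}

/-- The dual cone, in the space of real symmetric matrices with the trace inner product
`⟨X, A⟩ = Tr(Xᵀ A)`. -/
def symmDualCone {n : ℕ} (K : Set (Matrix (Fin n) (Fin n) ℝ)) :
    Set (Matrix (Fin n) (Fin n) ℝ) :=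
  {X | X.IsSymm ∧ ∀ A ∈ K, 0 ≤ (X.transpose * A).trace}

/-! Dually, `X` lies in the dual cone iff there is a functional `L`, nonnegative on squares of forms
of degree `t + 1`, with `L ((∑ xᵢ²)^(t-1) xₐ² x_b²) = X a b`. The proof exchanges such functionals
with Bose symmetric extensions `R`, whose entries depend only on the exponent vectors of the row and
column words (`IsBoseSymmetric.apply_eq`).

From `X` to `R`: `exists_extension_of_mem_symmDualCone` produces `L` by Riesz extension, with `(∑
xᵢ²)^(t+1)` as order unit. Put `L (x^(2α))` where both words have exponent `α`, and zero elsewhere.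
Each partial transpose is then the moment matrix of `L` cut down to diagonal blocks, hence positive
semidefinite.

From `R` to `X`: the diagonal of `R` gives the even moments, and all other moments are set to zero.
The moment matrix splits by parity class, and the block of `c` is a compression of `R^{T_{B[s]}}`
with `2 s + |c| = t + 1` (`sum_parityClass_nonneg`). This is where all `s ≤ (t + 1) / 2` come in. -/

/-- The exponent vector of the monomial `∏ r, x_(i r)` attached to a word `i`. -/
noncomputable def wordExp {n m : ℕ} (i : Fin m → Fin n) : Fin n →₀ ℕ :=
  ∑ r, Finsupp.single (i r) 1

/-! ### Words and their exponent vectors. -/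

section Words

variable {n m : ℕ}

lemma wordExp_apply (i : Fin m → Fin n) (a : Fin n) :
    wordExp i a = (Finset.univ.filter fun r => i r = a).card := by
  simp [wordExp, Finsupp.finsetSum_apply, Finsupp.single_apply]

lemma degree_wordExp (i : Fin m → Fin n) : (wordExp i).degree = m := by
  simp [wordExp]

lemma monomial_wordExp (i : Fin m → Fin n) :
    MvPolynomial.monomial (wordExp i) (1 : ℝ) = ∏ r, MvPolynomial.X (i r) := by
  simp [wordExp, MvPolynomial.X, MvPolynomial.monomial_sum_one]

lemma exists_perm_of_wordExp_eq {i j : Fin m → Fin n} (h : wordExp i = wordExp j) :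
    ∃ σ : Equiv.Perm (Fin m), ∀ r, j (σ r) = i r := by
  have e : ∀ a, Nonempty ({r // i r = a} ≃ {r // j r = a}) := fun a => by
    refine ⟨Fintype.equivOfCardEq ?_⟩
    rw [Fintype.card_subtype, Fintype.card_subtype, ← wordExp_apply, ← wordExp_apply, h]
  exact ⟨Equiv.ofFiberEquiv fun a => (e a).some, fun r => Equiv.ofFiberEquiv_map _ r⟩

lemma exists_sum_single_eq {ι σ : Type*} [DecidableEq ι] [Nonempty σ] (S : Finset ι)
    (α : σ →₀ ℕ) (h : α.degree = S.card) :
    ∃ f : ι → σ, ∑ r ∈ S, Finsupp.single (f r) 1 = α := by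
  classical
  induction S using Finset.induction_on generalizing α with
  | empty =>
    refine ⟨fun _ => Classical.arbitrary σ, ?_⟩
    have : α = 0 := (Finsupp.degree_eq_zero_iff α).mp (by simpa using h)
    simp [this]
  | insert a S ha ih =>
    rw [Finset.card_insert_of_notMem ha] at h
    have hα : α ≠ 0 := by
      rintro rfl
      rw [map_zero] at h
      omega
    obtain ⟨b, hb⟩ := Finsupp.ne_iff.mp hα
    have hle : Finsupp.single b 1 ≤ α := by
      rw [Finsupp.single_le_iff]
      exact Nat.one_le_iff_ne_zero.mpr hb
    obtain ⟨β, rfl⟩ := exists_add_of_le hle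
    obtain ⟨f, hf⟩ := ih β (by
      rw [map_add, Finsupp.degree_single] at h
      omega)
    refine ⟨Function.update f a b, ?_⟩
    rw [Finset.sum_insert ha, Function.update_self, ← hf]
    congr 1
    refine Finset.sum_congr rfl fun r hr => ?_
    rw [Function.update_of_ne (ne_of_mem_of_not_mem hr ha)]

lemma exists_wordExp_eq (α : Fin n →₀ ℕ) (h : α.degree = m) :
    ∃ i : Fin m → Fin n, wordExp i = α := by
  rcases isEmpty_or_nonempty (Fin n) with hn | hn
  · have hα : α = 0 := Subsingleton.elim _ _
    subst hα
    have hm : m = 0 := by simpa using h.symm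
    subst hm
    exact ⟨Fin.elim0, by simp [wordExp]⟩
  · exact exists_sum_single_eq Finset.univ α (by simpa using h)

lemma exists_add_of_degree_eq_add {σ : Type*} (α : σ →₀ ℕ) (k l : ℕ) (h : α.degree = k + l) :
    ∃ β γ : σ →₀ ℕ, α = β + γ ∧ β.degree = k ∧ γ.degree = l := by
  induction k generalizing α with
  | zero => exact ⟨0, α, by simp, by simp, by simpa using h⟩
  | succ k ih =>
    have hα : α ≠ 0 := by
      rintro rfl
      rw [map_zero] at h
      omega
    obtain ⟨b, hb⟩ := Finsupp.ne_iff.mp hα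
    have hle : Finsupp.single b 1 ≤ α := by
      rw [Finsupp.single_le_iff]
      exact Nat.one_le_iff_ne_zero.mpr hb
    obtain ⟨α', rfl⟩ := exists_add_of_le hle
    rw [map_add, Finsupp.degree_single] at h
    obtain ⟨β, γ, rfl, hβ, hγ⟩ := ih α' (by omega)
    exact ⟨Finsupp.single b 1 + β, γ, by rw [add_assoc], by
      rw [map_add, Finsupp.degree_single, hβ, add_comm], hγ⟩

lemma sum_X_sq_pow (k : ℕ) :
    (∑ i : Fin n, (MvPolynomial.X i : MvPolynomial (Fin n) ℝ) ^ 2) ^ k =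
      ∑ i : Fin k → Fin n, MvPolynomial.monomial (wordExp i) 1 ^ 2 := by
  rw [Fintype.sum_pow]
  refine Finset.sum_congr rfl fun i _ => ?_
  rw [monomial_wordExp, Finset.prod_pow]

lemma sum_concatIndex {M : Type*} [AddCommMonoid M] {t : ℕ} (ht : 1 ≤ t) (g : Fin n → M)
    (a b : Fin n) (k : Fin (t - 1) → Fin n) :
    ∑ r : Fin (t + 1), g (concatIndex a b k r) = g a + g b + ∑ r, g (k r) := by
  obtain ⟨t, rfl⟩ : ∃ s, t = s + 1 := ⟨t - 1, by omega⟩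
  rw [Fin.sum_univ_succ, Fin.sum_univ_succ, ← add_assoc]
  simp [concatIndex]

lemma wordExp_concatIndex {t : ℕ} (ht : 1 ≤ t) (a b : Fin n) (k : Fin (t - 1) → Fin n) :
    wordExp (concatIndex a b k : Fin (t + 1) → Fin n) =
      Finsupp.single a 1 + Finsupp.single b 1 + wordExp k :=
  sum_concatIndex ht (fun c => Finsupp.single c 1) a b k

lemma monomial_wordExp_concatIndex_sq {t : ℕ} (ht : 1 ≤ t) (a b : Fin n)
    (k : Fin (t - 1) → Fin n) :
    MvPolynomial.monomial (wordExp (concatIndex a b k : Fin (t + 1) → Fin n)) (1 : ℝ) ^ 2 =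
      MvPolynomial.X a ^ 2 * MvPolynomial.X b ^ 2 * MvPolynomial.monomial (wordExp k) 1 ^ 2 := by
  rw [wordExp_concatIndex ht, MvPolynomial.X, MvPolynomial.X, ← mul_pow, ← mul_pow,
    MvPolynomial.monomial_mul, MvPolynomial.monomial_mul, one_mul, one_mul]

/-- Exchanging the letters of `i` and `j` in the registers `1, …, s`, as in the row index of
`R^{T_{B[s]}}`. -/
def mixWord {t : ℕ} (s : ℕ) (i j : Fin (t + 1) → Fin n) : Fin (t + 1) → Fin n :=
  fun r => if 1 ≤ r.val ∧ r.val ≤ s then j r else i r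

lemma partialTransposeFirst_apply {t : ℕ} (s : ℕ)
    (R : Matrix (Fin (t + 1) → Fin n) (Fin (t + 1) → Fin n) ℂ) (i j : Fin (t + 1) → Fin n) :
    partialTransposeFirst s R i j = R (mixWord s i j) (mixWord s j i) := rfl

/-- The part of the exponent vector of a word coming from the registers `1, …, s`. -/
noncomputable def expInside {t : ℕ} (s : ℕ) (i : Fin (t + 1) → Fin n) : Fin n →₀ ℕ :=
  ∑ r with 1 ≤ (r : Fin (t + 1)).val ∧ r.val ≤ s, Finsupp.single (i r) 1

/-- The part of the exponent vector of a word coming from the registers outside `1, …, s`. -/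
noncomputable def expOutside {t : ℕ} (s : ℕ) (i : Fin (t + 1) → Fin n) : Fin n →₀ ℕ :=
  ∑ r with ¬(1 ≤ (r : Fin (t + 1)).val ∧ r.val ≤ s), Finsupp.single (i r) 1

lemma wordExp_eq_expInside_add {t : ℕ} (s : ℕ) (i : Fin (t + 1) → Fin n) :
    wordExp i = expInside s i + expOutside s i :=
  (Finset.sum_filter_add_sum_filter_not _ _ _).symm

lemma wordExp_mixWord {t : ℕ} (s : ℕ) (i j : Fin (t + 1) → Fin n) :
    wordExp (mixWord s i j) = expInside s j + expOutside s i := by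
  rw [wordExp_eq_expInside_add s]
  congr 1
  · refine Finset.sum_congr rfl fun r hr => ?_
    rw [mixWord, if_pos (Finset.mem_filter.mp hr).2]
  · refine Finset.sum_congr rfl fun r hr => ?_
    rw [mixWord, if_neg (Finset.mem_filter.mp hr).2]

lemma card_filter_inside {t s : ℕ} (hs : s ≤ t) :
    (Finset.univ.filter fun r : Fin (t + 1) => 1 ≤ r.val ∧ r.val ≤ s).card = s := by
  rw [← Finset.card_map Fin.valEmbedding]
  have : (Finset.univ.filter fun r : Fin (t + 1) => 1 ≤ r.val ∧ r.val ≤ s).map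
      Fin.valEmbedding = Finset.Icc 1 s := by
    ext x
    simp only [Finset.mem_map, Finset.mem_filter, Finset.mem_univ, true_and, Finset.mem_Icc,
      Fin.valEmbedding_apply]
    constructor
    · rintro ⟨r, hr, rfl⟩
      exact hr
    · intro hx
      exact ⟨⟨x, by omega⟩, hx, rfl⟩
  rw [this, Nat.card_Icc, Nat.add_sub_cancel]

lemma exists_word_expInside_expOutside {t s : ℕ} (hs : s ≤ t) (β α : Fin n →₀ ℕ)
    (hβ : β.degree = s) (hα : α.degree = t + 1 - s) :
    ∃ i : Fin (t + 1) → Fin n, expInside s i = β ∧ expOutside s i = α := by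
  rcases isEmpty_or_nonempty (Fin n) with hn | hn
  · have h0 : α = 0 := Subsingleton.elim _ _
    subst h0
    simp at hα
    omega
  obtain ⟨f, hf⟩ := exists_sum_single_eq
    (Finset.univ.filter fun r : Fin (t + 1) => 1 ≤ r.val ∧ r.val ≤ s) β
    (by rw [card_filter_inside hs, hβ])
  obtain ⟨g, hg⟩ := exists_sum_single_eq
    (Finset.univ.filter fun r : Fin (t + 1) => ¬(1 ≤ r.val ∧ r.val ≤ s)) α (by
      have := Finset.card_filter_add_card_filter_not (s := (Finset.univ : Finset (Fin (t + 1))))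
        (fun r => 1 ≤ r.val ∧ r.val ≤ s)
      rw [card_filter_inside hs, Finset.card_univ, Fintype.card_fin] at this
      rw [hα]
      omega)
  refine ⟨mixWord s g f, ?_, ?_⟩
  · rw [← hf]
    refine Finset.sum_congr rfl fun r hr => ?_
    rw [mixWord, if_pos (Finset.mem_filter.mp hr).2]
  · rw [← hg]
    refine Finset.sum_congr rfl fun r hr => ?_
    rw [mixWord, if_neg (Finset.mem_filter.mp hr).2]

/-- Words with equal exponents are rearrangements of each other; column symmetry passes to rows by
Hermiticity. -/
lemma IsBoseSymmetric.apply_eq {R : Matrix (Fin m → Fin n) (Fin m → Fin n) ℂ}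
    (hR : IsBoseSymmetric R) {i i' j j' : Fin m → Fin n} (hi : wordExp i = wordExp i')
    (hj : wordExp j = wordExp j') : R i j = R i' j' := by
  have col : ∀ i j j' : Fin m → Fin n, wordExp j = wordExp j' → R i j = R i j' := by
    intro i j j' h
    obtain ⟨σ, hσ⟩ := exists_perm_of_wordExp_eq h
    rw [← hR.2 σ i j', funext hσ]
  rw [col i j j' hj, ← hR.1.apply i j', col j' i i' hi, hR.1.apply]

end Words

/-- After the partial transpose, the two kinds of nonzero entries sit at `(ab, ab)` and `(ab, ba)`,
so together they are described by equality of the multisets `{a, b}` and `{c, d}`. -/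
lemma partialTransposeB_rhoPair_apply {n : ℕ} (X : Matrix (Fin n) (Fin n) ℝ) (p q : Fin n × Fin n) :
    partialTransposeB (rhoPair X (X.map (fun x : ℝ => (x : ℂ)))) p q =
      if Finsupp.single p.1 1 + Finsupp.single p.2 1 =
        (Finsupp.single q.1 1 + Finsupp.single q.2 1 : Fin n →₀ ℕ) then (X p.1 p.2 : ℂ) else 0 := by
  obtain ⟨a, b⟩ := p
  obtain ⟨c, d⟩ := q
  have key : (Finsupp.single a 1 + Finsupp.single b 1 =
      (Finsupp.single c 1 + Finsupp.single d 1 : Fin n →₀ ℕ)) ↔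
      (a = c ∧ b = d) ∨ (a = d ∧ b = c) := by
    constructor
    · intro h
      have := congrArg Finsupp.toMultiset h
      simp only [map_add, Finsupp.toMultiset_single, one_smul, Multiset.singleton_add] at this
      rw [← Multiset.cons_zero, ← Multiset.cons_zero, Multiset.cons_eq_cons] at this
      simp at this
      tauto
    · rintro (⟨rfl, rfl⟩ | ⟨rfl, rfl⟩)
      · rfl
      · rw [add_comm]
  simp only [partialTransposeB, rhoPair, Matrix.of_apply, Prod.mk.injEq, key, Matrix.map_apply]
  clear key
  by_cases h1 : a = c <;> by_cases h2 : b = d <;> by_cases h3 : a = d <;> by_cases h4 : b = c <;>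
    simp_all [eq_comm]

/-! ### Positivity tools. -/

lemma IsSumSq.smul_real {σ : Type*} {p : MvPolynomial σ ℝ} (hp : IsSumSq p) {c : ℝ} (hc : 0 ≤ c) :
    IsSumSq (c • p) := by
  rw [MvPolynomial.smul_eq_C_mul]
  refine IsSumSq.mul ?_ hp
  rw [← Real.mul_self_sqrt hc, MvPolynomial.C_mul]
  exact IsSumSq.mul_self _

open scoped MatrixOrder in
lemma Matrix.PosSemidef.map_ofReal {ι : Type*} [Fintype ι] {S : Matrix ι ι ℝ}
    (hS : S.PosSemidef) : (S.map (fun x : ℝ => (x : ℂ))).PosSemidef := by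
  classical
  obtain ⟨B, rfl⟩ := CStarAlgebra.nonneg_iff_eq_star_mul_self.mp hS.nonneg
  rw [Matrix.star_eq_conjTranspose]
  have : (B.conjTranspose * B).map (fun x : ℝ => (x : ℂ)) =
      (B.map (fun x : ℝ => (x : ℂ))).conjTranspose * B.map (fun x : ℝ => (x : ℂ)) := by
    ext i j
    simp [Matrix.mul_apply]
  rw [this]
  exact Matrix.posSemidef_conjTranspose_mul_self _

/-- A Gram-type matrix of a functional that is nonnegative on squares, cut down to the blocks
given by `d`, is positive semidefinite. -/
lemma posSemidef_blockGram {ι D A : Type*} [Fintype ι] [DecidableEq D] [CommRing A] [Algebra ℝ A]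
    (L : A →ₗ[ℝ] ℝ) (q : ι → A) (d : ι → D)
    (hL : ∀ y : ι → ℝ, 0 ≤ L ((∑ i, y i • q i) * ∑ i, y i • q i)) :
    (Matrix.of fun i j => if d i = d j then L (q i * q j) else 0 : Matrix ι ι ℝ).PosSemidef := by
  refine Matrix.PosSemidef.of_dotProduct_mulVec_nonneg ?_ fun y => ?_
  · ext i j
    simp [eq_comm, mul_comm]
  -- The quadratic form splits over the values `c` of `d`; each block contributes `L` of a square,
  -- namely that of the combination truncated to `d i = c`.
  · have key : star y ⬝ᵥ ((Matrix.of fun i j => if d i = d j then L (q i * q j) else 0 :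
        Matrix ι ι ℝ).mulVec y) = ∑ c ∈ Finset.univ.image d,
          L ((∑ i, (if d i = c then y i else 0) • q i) *
            ∑ i, (if d i = c then y i else 0) • q i) := by
      simp only [dotProduct, Matrix.mulVec, Finset.sum_mul_sum, map_sum, smul_mul_smul_comm,
        map_smul, Matrix.of_apply, star_trivial, smul_eq_mul]
      simp only [Finset.mul_sum]
      rw [Finset.sum_comm (s := Finset.univ.image d)]
      refine Finset.sum_congr rfl fun i _ => ?_
      rw [Finset.sum_comm (s := Finset.univ.image d)]
      refine Finset.sum_congr rfl fun j _ => ?_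
      rw [Finset.sum_eq_single (d i)]
      · by_cases h : d i = d j
        · rw [if_pos h, if_pos rfl, if_pos h.symm]
          ring
        · rw [if_neg h, if_neg (Ne.symm h)]
          ring
      · intro c _ hc
        rw [if_neg (Ne.symm hc)]
        ring
      · intro h
        exact absurd (Finset.mem_image_of_mem d (Finset.mem_univ i)) h
    rw [key]
    exact Finset.sum_nonneg fun c _ => hL _

/-! ### Extending functionals from the dual cone. -/

section Extension

variable {n m : ℕ}

open MvPolynomial

lemma isHomogeneous_sum_X_sq_pow (k : ℕ) :
    ((∑ i : Fin n, (X i : MvPolynomial (Fin n) ℝ) ^ 2) ^ k).IsHomogeneous (2 * k) :=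
  (IsHomogeneous.sum _ _ _ fun i _ => by simpa using (isHomogeneous_X ℝ i).pow 2).pow k

lemma isHomogeneous_quarticForm (A : Matrix (Fin n) (Fin n) ℝ) :
    (quarticForm A).IsHomogeneous 4 := by
  refine IsHomogeneous.sum _ _ _ fun i _ => IsHomogeneous.sum _ _ _ fun j _ => ?_
  have h : ∀ a : Fin n, (X a ^ 2 : MvPolynomial (Fin n) ℝ).IsHomogeneous 2 := fun a => by
    simpa using (isHomogeneous_X ℝ a).pow 2
  simpa using ((isHomogeneous_C _ (A i j)).mul (h i)).mul (h j)

/-- The linear map `A ↦ (∑ xᵢ²)^k f_A`. -/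
noncomputable def multQuarticForm (n k : ℕ) :
    Matrix (Fin n) (Fin n) ℝ →ₗ[ℝ] MvPolynomial (Fin n) ℝ where
  toFun A := (∑ i : Fin n, (X i : MvPolynomial (Fin n) ℝ) ^ 2) ^ k * quarticForm A
  map_add' A B := by
    rw [← mul_add]
    congr 1
    simp only [quarticForm, Matrix.add_apply, C_add, add_mul, Finset.sum_add_distrib]
  map_smul' c A := by
    rw [RingHom.id_apply, ← mul_smul_comm]
    congr 1
    simp only [quarticForm, Matrix.smul_apply, smul_eq_mul, C_mul, Finset.smul_sum,
      smul_eq_C_mul, mul_assoc]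

lemma multQuarticForm_apply (k : ℕ) (A : Matrix (Fin n) (Fin n) ℝ) :
    multQuarticForm n k A =
      (∑ i : Fin n, (X i : MvPolynomial (Fin n) ℝ) ^ 2) ^ k * quarticForm A := rfl

lemma isHomogeneous_multQuarticForm (k : ℕ) (A : Matrix (Fin n) (Fin n) ℝ) :
    (multQuarticForm n k A).IsHomogeneous (2 * k + 4) :=
  (isHomogeneous_sum_X_sq_pow k).mul (isHomogeneous_quarticForm A)

lemma quarticForm_transpose (A : Matrix (Fin n) (Fin n) ℝ) :
    quarticForm A.transpose = quarticForm A := by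
  rw [quarticForm, Finset.sum_comm]
  refine Finset.sum_congr rfl fun i _ => Finset.sum_congr rfl fun j _ => ?_
  rw [Matrix.transpose_apply]
  ring

lemma multQuarticForm_transpose (k : ℕ) (A : Matrix (Fin n) (Fin n) ℝ) :
    multQuarticForm n k A.transpose = multQuarticForm n k A := by
  rw [multQuarticForm_apply, multQuarticForm_apply, quarticForm_transpose]

lemma multQuarticForm_single (k : ℕ) (a b : Fin n) :
    multQuarticForm n k (Matrix.single a b 1) =
      (∑ i : Fin n, (X i : MvPolynomial (Fin n) ℝ) ^ 2) ^ k * (X a ^ 2 * X b ^ 2) := by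
  rw [multQuarticForm_apply]
  congr 1
  rw [quarticForm, Finset.sum_eq_single a, Finset.sum_eq_single b]
  · simp
  · intro j _ hj
    simp [Ne.symm hj]
  · simp
  · intro i _ hi
    simp [Ne.symm hi]
  · simp

lemma multQuarticForm_ones (k : ℕ) :
    multQuarticForm n k (Matrix.of fun _ _ => 1) =
      (∑ i : Fin n, (X i : MvPolynomial (Fin n) ℝ) ^ 2) ^ (k + 2) := by
  rw [multQuarticForm_apply, pow_add]
  congr 1
  simp [quarticForm, sq (∑ i : Fin n, (X i : MvPolynomial (Fin n) ℝ) ^ 2), Finset.sum_mul_sum]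

/-- The cone of polynomials whose homogeneous component of degree `d` is a sum of squares. -/
noncomputable def sumSqComponentCone (n d : ℕ) : PointedCone ℝ (MvPolynomial (Fin n) ℝ) where
  carrier := {p | IsSumSq (homogeneousComponent d p)}
  add_mem' {p q} hp hq := by
    rw [Set.mem_ofPred_eq, map_add]
    exact IsSumSq.add hp hq
  zero_mem' := by
    rw [Set.mem_ofPred_eq, map_zero]
    exact IsSumSq.zero
  smul_mem' c p hp := by
    change IsSumSq (homogeneousComponent d ((c : ℝ) • p))
    rw [map_smul]
    exact IsSumSq.smul_real hp c.2

lemma mem_sumSqComponentCone {d : ℕ} {p : MvPolynomial (Fin n) ℝ} :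
    p ∈ sumSqComponentCone n d ↔ IsSumSq (homogeneousComponent d p) := Iff.rfl

lemma mem_sumSqComponentCone_of_isHomogeneous {d : ℕ} {p : MvPolynomial (Fin n) ℝ}
    (hp : p.IsHomogeneous d) : p ∈ sumSqComponentCone n d ↔ IsSumSq p := by
  rw [mem_sumSqComponentCone, homogeneousComponent_eq_self hp]

/-- The power expands into squares of monomials indexed by words, and `monomial α 1 ^ 2` is one of
the terms. -/
lemma isSumSq_sum_X_sq_pow_sub (α : Fin n →₀ ℕ) (hα : α.degree = m) :
    IsSumSq ((∑ i : Fin n, (X i : MvPolynomial (Fin n) ℝ) ^ 2) ^ m - monomial α 1 ^ 2) := by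
  classical
  obtain ⟨i, rfl⟩ := exists_wordExp_eq α hα
  rw [sum_X_sq_pow, ← Finset.add_sum_erase _ _ (Finset.mem_univ i), add_sub_cancel_left]
  exact IsSumSq.sum_sq _ _

/-- The order unit property required by Riesz extension. In degree `2 m` it follows from `±2 x^α x^β
= (x^α ± x^β)² - x^(2α) - x^(2β)`; monomials of other degrees have zero component. -/
lemma exists_smul_sum_X_sq_pow_add_mem (m : ℕ) (p : MvPolynomial (Fin n) ℝ) :
    ∃ N : ℝ, N • (∑ i : Fin n, (X i : MvPolynomial (Fin n) ℝ) ^ 2) ^ m + p ∈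
      sumSqComponentCone n (2 * m) := by
  induction p using MvPolynomial.induction_on' with
  | monomial γ c =>
    by_cases hγ : γ.degree = 2 * m
    · obtain ⟨α, β, rfl, hα, hβ⟩ := exists_add_of_degree_eq_add γ m m (by omega)
      refine ⟨|c|, ?_⟩
      rw [mem_sumSqComponentCone_of_isHomogeneous
        ((Submodule.smul_mem (homogeneousSubmodule (Fin n) ℝ _) _
          (isHomogeneous_sum_X_sq_pow m)).add (isHomogeneous_monomial c hγ))]
      have hm : monomial (α + β) c = c • (monomial α (1 : ℝ) * monomial β 1) := by
        simp [monomial_mul, smul_monomial]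
      have hsq : ∀ p : MvPolynomial (Fin n) ℝ, IsSumSq (p ^ 2) := fun p => by
        rw [sq]
        exact IsSumSq.mul_self p
      have h1 := (isSumSq_sum_X_sq_pow_sub α hα).add (isSumSq_sum_X_sq_pow_sub β hβ)
      obtain ⟨d, rfl⟩ : ∃ d : ℝ, c = d + d := ⟨c / 2, by ring⟩
      rcases le_total 0 d with hd | hd
      · convert (h1.add (hsq (monomial α 1 + monomial β 1))).smul_real hd using 1
        rw [hm, abs_of_nonneg (add_nonneg hd hd)]
        simp only [smul_eq_C_mul, C_add]
        ring
      · convert (h1.add (hsq (monomial α 1 - monomial β 1))).smul_real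
          (neg_nonneg.mpr hd) using 1
        rw [hm, abs_of_nonpos (add_nonpos hd hd)]
        simp only [smul_eq_C_mul, C_add, C_neg]
        ring
    · refine ⟨0, ?_⟩
      rw [zero_smul, zero_add, mem_sumSqComponentCone,
        homogeneousComponent_of_mem (isHomogeneous_monomial c rfl), if_neg (Ne.symm hγ)]
      exact IsSumSq.zero
  | add p q hp hq =>
    obtain ⟨N, hN⟩ := hp
    obtain ⟨M, hM⟩ := hq
    refine ⟨N + M, ?_⟩
    convert add_mem hN hM using 1
    module

/-- A positive functional on `K^(k)_n` extends to a functional that is nonnegative on sums of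
squares of degree `2 (k + 2)`. -/
lemma exists_extension_of_mem_symmDualCone {k : ℕ} {Y : Matrix (Fin n) (Fin n) ℝ}
    (hY : Y ∈ symmDualCone (coneK n k)) :
    ∃ L : MvPolynomial (Fin n) ℝ →ₗ[ℝ] ℝ,
      (∀ p : MvPolynomial (Fin n) ℝ, p.IsHomogeneous (k + 2) → 0 ≤ L (p * p)) ∧
      ∀ a b, L ((∑ i : Fin n, (X i : MvPolynomial (Fin n) ℝ) ^ 2) ^ k * (X a ^ 2 * X b ^ 2)) =
        Y a b := by
  obtain ⟨hsymm, hpos⟩ := hY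
  let φ : Matrix (Fin n) (Fin n) ℝ →ₗ[ℝ] ℝ :=
    (Matrix.traceLinearMap (Fin n) ℝ ℝ) ∘ₗ LinearMap.mulLeft ℝ Y.transpose
  have hφ : ∀ A, φ A = (Y.transpose * A).trace := fun A => rfl
  have hφt : ∀ A, φ A.transpose = φ A := fun A => by
    rw [hφ, hφ, ← Matrix.trace_transpose, Matrix.transpose_mul, Matrix.transpose_transpose,
      Matrix.transpose_transpose, Matrix.trace_mul_comm, hsymm.eq]
  have hnonneg : ∀ A, IsSumSq (multQuarticForm n k A) → 0 ≤ φ A := by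
    intro A hA
    -- The cone only contains symmetric matrices; symmetrizing doubles both `φ A` and the
    -- polynomial.
    have hmem : A + A.transpose ∈ coneK n k := by
      refine ⟨Matrix.isSymm_add_transpose_self A, ?_⟩
      rw [← multQuarticForm_apply, map_add, multQuarticForm_transpose]
      exact hA.add hA
    have := hpos _ hmem
    rw [← hφ, map_add, hφt] at this
    linarith
  -- For `A` in the kernel, both `A` and `-A` map to the sum of squares `0`, so `φ A = 0` and `φ`
  -- factors through the polynomials.
  have hker : LinearMap.ker (multQuarticForm n k) ≤ LinearMap.ker φ := by
    intro A hA
    rw [LinearMap.mem_ker] at hA ⊢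
    refine le_antisymm ?_ (hnonneg A (hA ▸ IsSumSq.zero))
    have := hnonneg (-A) (by rw [map_neg, hA, neg_zero]; exact IsSumSq.zero)
    rw [map_neg] at this
    linarith
  obtain ⟨g, hg⟩ : ∃ g : MvPolynomial (Fin n) ℝ →ₗ[ℝ] ℝ, g ∘ₗ multQuarticForm n k = φ := by
    have : φ ∈ (LinearMap.ker (multQuarticForm n k)).dualAnnihilator := by
      rw [Submodule.mem_dualAnnihilator]
      exact fun A hA => hker hA
    rw [← LinearMap.range_dualMap_eq_dualAnnihilator_ker] at this
    exact this
  obtain ⟨L, hL1, hL2⟩ := riesz_extension (sumSqComponentCone n (2 * (k + 2)))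
    (g.toPMap (LinearMap.range (multQuarticForm n k))) (by
      rintro ⟨_, A, rfl⟩ hA
      have hA' := (mem_sumSqComponentCone_of_isHomogeneous (isHomogeneous_multQuarticForm k A)).mp hA
      exact (hnonneg A hA').trans_eq (LinearMap.congr_fun hg A).symm) (by
      intro p
      obtain ⟨N, hN⟩ := exists_smul_sum_X_sq_pow_add_mem (k + 2) p
      -- The order unit lies in the domain: it is the image of the all-ones matrix.
      refine ⟨⟨_, N • Matrix.of fun _ _ => 1, rfl⟩, ?_⟩
      change multQuarticForm n k (N • Matrix.of fun _ _ => 1) + p ∈ _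
      rwa [map_smul, multQuarticForm_ones])
  refine ⟨L, fun p hp => ?_, fun a b => ?_⟩
  · refine hL2 _ ?_
    have := hp.mul hp
    rw [← two_mul] at this
    rw [mem_sumSqComponentCone_of_isHomogeneous this]
    exact IsSumSq.mul_self p
  · rw [← multQuarticForm_single]
    have h1 : L (multQuarticForm n k (Matrix.single a b 1)) = φ (Matrix.single a b 1) :=
      (hL1 ⟨_, Matrix.single a b 1, rfl⟩).trans (LinearMap.congr_fun hg _)
    rw [h1, hφ, Matrix.trace_mul_single]
    simp

end Extension

/-! ### From functionals to Bose symmetric extensions. -/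

section BoseExtension

variable {n t : ℕ}

open MvPolynomial

/-- The Bose symmetric matrix whose nonzero entries are the values of a functional at squares of
monomials. -/
noncomputable def boseOfFunctional (t : ℕ) (L : MvPolynomial (Fin n) ℝ →ₗ[ℝ] ℝ) :
    Matrix (Fin (t + 1) → Fin n) (Fin (t + 1) → Fin n) ℂ :=
  Matrix.of fun i j =>
    if wordExp i = wordExp j then ((L (monomial (wordExp i) 1 ^ 2) : ℝ) : ℂ) else 0

lemma isBoseSymmetric_boseOfFunctional (L : MvPolynomial (Fin n) ℝ →ₗ[ℝ] ℝ) :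
    IsBoseSymmetric (boseOfFunctional t L) := by
  refine ⟨?_, fun σ i j => ?_⟩
  · ext i j
    by_cases h : wordExp i = wordExp j
    · simp [boseOfFunctional, h]
    · simp [boseOfFunctional, h, Ne.symm h]
  · have : wordExp (fun r => j (σ r)) = wordExp j :=
      Equiv.sum_comp σ fun r => Finsupp.single (j r) 1
    simp [boseOfFunctional, this]

lemma posSemidef_partialTransposeFirst_boseOfFunctional (s : ℕ)
    (L : MvPolynomial (Fin n) ℝ →ₗ[ℝ] ℝ)
    (hL : ∀ p : MvPolynomial (Fin n) ℝ, p.IsHomogeneous (t + 1) → 0 ≤ L (p * p)) :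
    (partialTransposeFirst s (boseOfFunctional t L)).PosSemidef := by
  -- Blocks are labelled by outside minus inside exponents, taken in `ℤ` since the difference can be
  -- negative. The two mixed words have equal exponents exactly when these labels agree.
  have key := (posSemidef_blockGram L (fun i : Fin (t + 1) → Fin n => monomial (wordExp i) (1 : ℝ))
    (fun i a => (expOutside s i a : ℤ) - expInside s i a) (fun y => hL _
      (IsHomogeneous.sum _ _ _ fun i _ =>
        Submodule.smul_mem (homogeneousSubmodule (Fin n) ℝ _) _
          (isHomogeneous_monomial _ (degree_wordExp i))))).map_ofReal
  convert key using 1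
  ext i j
  have hiff : wordExp (mixWord s i j) = wordExp (mixWord s j i) ↔
      (fun a => (expOutside s i a : ℤ) - expInside s i a) =
        fun a => (expOutside s j a : ℤ) - expInside s j a := by
    rw [wordExp_mixWord, wordExp_mixWord, Finsupp.ext_iff, _root_.funext_iff]
    refine forall_congr' fun a => ?_
    rw [Finsupp.add_apply, Finsupp.add_apply]
    omega
  rw [partialTransposeFirst_apply, boseOfFunctional, Matrix.of_apply, Matrix.map_apply,
    Matrix.of_apply]
  by_cases h : wordExp (mixWord s i j) = wordExp (mixWord s j i)
  · rw [if_pos h, if_pos (hiff.mp h), monomial_mul, sq, monomial_mul]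
    -- The doubled exponent becomes the sum of those of the two mixed words, which equals `wordExp i
    -- + wordExp j`.
    nth_rewrite 2 [h]
    rw [wordExp_mixWord, wordExp_mixWord, wordExp_eq_expInside_add s i,
      wordExp_eq_expInside_add s j]
    congr 4
    abel
  · rw [if_neg h, if_neg (fun h' => h (hiff.mpr h')), Complex.ofReal_zero]

/-- The traced letters cancel in the comparison of exponents, and summing over them rebuilds `(∑
xᵢ²)^(t-1)`. -/
lemma partialTraceLast_boseOfFunctional (ht : 1 ≤ t) (L : MvPolynomial (Fin n) ℝ →ₗ[ℝ] ℝ)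
    (p q : Fin n × Fin n) :
    partialTraceLast (boseOfFunctional t L) p q =
      if Finsupp.single p.1 1 + Finsupp.single p.2 1 =
        (Finsupp.single q.1 1 + Finsupp.single q.2 1 : Fin n →₀ ℕ) then
        ((L ((∑ i : Fin n, (X i : MvPolynomial (Fin n) ℝ) ^ 2) ^ (t - 1) *
          (X p.1 ^ 2 * X p.2 ^ 2)) : ℝ) : ℂ) else 0 := by
  simp only [partialTraceLast, boseOfFunctional, Matrix.of_apply,
    monomial_wordExp_concatIndex_sq ht]
  simp only [wordExp_concatIndex ht, add_left_inj]
  split_ifs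
  · rw [sum_X_sq_pow, Finset.sum_mul, map_sum, Complex.ofReal_sum]
    refine Finset.sum_congr rfl fun k _ => ?_
    rw [mul_comm]
  · exact Finset.sum_const_zero

lemma mem_DPSBose_of_mem_symmDualCone (ht : 1 ≤ t) {Y : Matrix (Fin n) (Fin n) ℝ}
    (hY : Y ∈ symmDualCone (coneK n (t - 1))) :
    partialTransposeB (rhoPair Y (Y.map (fun x : ℝ => (x : ℂ)))) ∈ DPSBose n t := by
  obtain ⟨L, hL, hLY⟩ := exists_extension_of_mem_symmDualCone hY
  rw [show t - 1 + 2 = t + 1 by omega] at hL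
  have hρ : partialTransposeB (rhoPair Y (Y.map (fun x : ℝ => (x : ℂ)))) =
      partialTraceLast (boseOfFunctional t L) := by
    ext p q
    rw [partialTransposeB_rhoPair_apply, partialTraceLast_boseOfFunctional ht, hLY]
  refine ⟨?_, boseOfFunctional t L, isBoseSymmetric_boseOfFunctional L,
    fun s _ => posSemidef_partialTransposeFirst_boseOfFunctional s L hL, hρ⟩
  rw [hρ]
  ext p q
  simp only [Matrix.conjTranspose_apply, partialTraceLast, Matrix.of_apply, star_sum]
  exact Finset.sum_congr rfl fun k _ => (isBoseSymmetric_boseOfFunctional L).1.apply _ _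

end BoseExtension

/-! ### Sums of squares that are forms are sums of squares of forms. -/

section LowestDegree

variable {σ : Type*}

open MvPolynomial

lemma IsSumSq.exists_list {A : Type*} [Semiring A] {a : A} (h : IsSumSq a) :
    ∃ l : List A, a = (l.map fun q => q * q).sum := by
  induction h with
  | zero => exact ⟨[], rfl⟩
  | sq_add q _ ih =>
    obtain ⟨l, rfl⟩ := ih
    exact ⟨q :: l, by simp⟩

lemma homogeneousComponent_mul_self {m : ℕ} {q : MvPolynomial σ ℝ}
    (hq : ∀ γ : σ →₀ ℕ, γ.degree < m → coeff γ q = 0) :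
    homogeneousComponent (2 * m) (q * q) =
      homogeneousComponent m q * homogeneousComponent m q := by
  classical
  ext γ
  rw [coeff_homogeneousComponent, coeff_mul, coeff_mul]
  by_cases hγ : γ.degree = 2 * m
  · rw [if_pos hγ]
    refine Finset.sum_congr rfl fun x hx => ?_
    have hx' : x.1.degree + x.2.degree = 2 * m := by
      rw [← map_add, Finset.HasAntidiagonal.mem_antidiagonal.mp hx, hγ]
    rw [coeff_homogeneousComponent, coeff_homogeneousComponent]
    rcases lt_trichotomy x.1.degree m with h | h | h
    · rw [hq _ h, if_neg h.ne, zero_mul, zero_mul]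
    · rw [if_pos h, if_pos (by omega)]
    · rw [hq x.2 (by omega), if_neg h.ne', mul_zero, zero_mul]
  · rw [if_neg hγ]
    refine (Finset.sum_eq_zero fun x hx => ?_).symm
    rw [coeff_homogeneousComponent, coeff_homogeneousComponent]
    by_cases h1 : x.1.degree = m
    · rw [if_neg (c := x.2.degree = m), mul_zero]
      intro h2
      apply hγ
      rw [← Finset.HasAntidiagonal.mem_antidiagonal.mp hx, map_add, h1, h2, two_mul]
    · rw [if_neg h1, zero_mul]

lemma homogeneousComponent_list_sum {m : ℕ} {l : List (MvPolynomial σ ℝ)}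
    (hl : ∀ q ∈ l, ∀ γ : σ →₀ ℕ, γ.degree < m → coeff γ q = 0) :
    homogeneousComponent (2 * m) (l.map fun q => q * q).sum =
      (l.map fun q => homogeneousComponent m q * homogeneousComponent m q).sum := by
  rw [map_list_sum, List.map_map]
  exact congrArg List.sum (List.map_congr_left fun q hq => homogeneousComponent_mul_self (hl q hq))

lemma eq_zero_of_list_sum_mul_self_eq_zero {l : List (MvPolynomial σ ℝ)}
    (h : (l.map fun q => q * q).sum = 0) : ∀ q ∈ l, q = 0 := by
  intro q hq
  refine MvPolynomial.funext fun x => ?_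
  have h' := congrArg (eval x) h
  rw [map_list_sum, List.map_map, map_zero] at h'
  have hnn : ∀ y ∈ l.map (eval x ∘ fun q => q * q), (0 : ℝ) ≤ y := by
    intro y hy
    obtain ⟨p, -, rfl⟩ := List.mem_map.mp hy
    simpa using mul_self_nonneg (eval x p)
  have h1 : eval x (q * q) ≤ 0 := (List.single_le_sum hnn _ (List.mem_map_of_mem hq)).trans_eq h'
  rw [map_mul] at h1
  rw [map_zero]
  exact mul_self_eq_zero.mp (h1.antisymm (mul_self_nonneg _))

/-- Lowest components cannot cancel: if every `q` vanishes below degree `m`, the degree `2 m`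
component of the sum is the sum of squares of the degree `m` components, and over the reals it is
zero only if each of them is. -/
lemma coeff_eq_zero_of_list_sum {m : ℕ} {l : List (MvPolynomial σ ℝ)}
    (h : ∀ γ : σ →₀ ℕ, γ.degree < 2 * m → coeff γ (l.map fun q => q * q).sum = 0) :
    ∀ q ∈ l, ∀ γ : σ →₀ ℕ, γ.degree < m → coeff γ q = 0 := by
  induction m with
  | zero => exact fun q _ γ hγ => absurd hγ (Nat.not_lt_zero _)
  | succ m ih =>
    have ih' := ih fun γ hγ => h γ (by omega)
    have h0 : ((l.map fun q => homogeneousComponent m q).map fun q => q * q).sum = 0 := by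
      rw [List.map_map]
      refine (homogeneousComponent_list_sum ih').symm.trans ?_
      ext γ
      rw [coeff_homogeneousComponent, coeff_zero]
      split_ifs with hγ
      · exact h γ (by omega)
      · rfl
    intro q hq γ hγ
    rcases Nat.lt_succ_iff_lt_or_eq.mp hγ with hlt | heq
    · exact ih' q hq γ hlt
    · have := eq_zero_of_list_sum_mul_self_eq_zero h0 _ (List.mem_map_of_mem hq)
      have := congrArg (coeff γ) this
      rwa [coeff_homogeneousComponent, if_pos heq, coeff_zero] at this

/-- A form of degree `2 * m` that is a sum of squares of polynomials is a sum of squares of forms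
of degree `m`. -/
lemma IsSumSq.exists_list_isHomogeneous {m : ℕ} {F : MvPolynomial σ ℝ} (hF : IsSumSq F)
    (hhom : F.IsHomogeneous (2 * m)) :
    ∃ l : List (MvPolynomial σ ℝ), (∀ q ∈ l, q.IsHomogeneous m) ∧
      F = (l.map fun q => q * q).sum := by
  obtain ⟨l, rfl⟩ := hF.exists_list
  refine ⟨l.map fun q => homogeneousComponent m q, ?_, ?_⟩
  · intro q hq
    obtain ⟨p, -, rfl⟩ := List.mem_map.mp hq
    exact homogeneousComponent_isHomogeneous m p
  · rw [List.map_map]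
    refine (homogeneousComponent_eq_self hhom).symm.trans (homogeneousComponent_list_sum ?_)
    exact coeff_eq_zero_of_list_sum fun γ hγ => hhom.coeff_eq_zero hγ.ne

end LowestDegree

/-! ### Parity classes and moments: from extensions to functionals. -/

section Parity

variable {σ : Type*}

/-- The parity class of an exponent vector. -/
noncomputable def parityExp (δ : σ →₀ ℕ) : σ →₀ ℕ := δ.mapRange (· % 2) rfl

/-- Half of an exponent vector, rounded down. -/
noncomputable def halfExp (δ : σ →₀ ℕ) : σ →₀ ℕ := δ.mapRange (· / 2) rfl

lemma parityExp_add_two_nsmul_halfExp (δ : σ →₀ ℕ) : parityExp δ + 2 • halfExp δ = δ := by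
  ext a
  simp [parityExp, halfExp, Nat.mod_add_div]

lemma parityExp_eq_of_add_eq_two_nsmul {δ ε α : σ →₀ ℕ} (h : δ + ε = 2 • α) :
    parityExp δ = parityExp ε := by
  ext a
  have := DFunLike.congr_fun h a
  simp only [Finsupp.add_apply, Finsupp.smul_apply, smul_eq_mul] at this
  simp only [parityExp, Finsupp.mapRange_apply]
  omega

end Parity

section Moments

variable {n t : ℕ}

open MvPolynomial

open Classical in
/-- The moment attached to an exponent vector: the diagonal entry of `R` at a word `i` if the vector
is twice the exponent vector of `i`, and zero if there is no such word. -/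
noncomputable def diagMoment (R : Matrix (Fin (t + 1) → Fin n) (Fin (t + 1) → Fin n) ℂ)
    (γ : Fin n →₀ ℕ) : ℝ :=
  if h : ∃ i : Fin (t + 1) → Fin n, 2 • wordExp i = γ then (R h.choose h.choose).re else 0

/-- The chosen word may differ from `i`, but it has the same exponents, and Bose symmetry makes the
entry the same. -/
lemma diagMoment_two_nsmul {R : Matrix (Fin (t + 1) → Fin n) (Fin (t + 1) → Fin n) ℂ}
    (hR : IsBoseSymmetric R) (i : Fin (t + 1) → Fin n) :
    diagMoment R (2 • wordExp i) = (R i i).re := by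
  have h : ∃ j : Fin (t + 1) → Fin n, 2 • wordExp j = 2 • wordExp i := ⟨i, rfl⟩
  have h' : wordExp h.choose = wordExp i := by
    ext a
    have := DFunLike.congr_fun h.choose_spec a
    simpa using this
  rw [diagMoment, dif_pos h, hR.apply_eq h' h']

lemma diagMoment_add_eq_zero (R : Matrix (Fin (t + 1) → Fin n) (Fin (t + 1) → Fin n) ℂ)
    {δ ε : Fin n →₀ ℕ} (h : parityExp δ ≠ parityExp ε) : diagMoment R (δ + ε) = 0 :=
  dif_neg fun ⟨_, hi⟩ => h (parityExp_eq_of_add_eq_two_nsmul hi.symm)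

/-- The linear functional on polynomials with the moments `diagMoment R`. -/
noncomputable def momentFunctional (R : Matrix (Fin (t + 1) → Fin n) (Fin (t + 1) → Fin n) ℂ) :
    MvPolynomial (Fin n) ℝ →ₗ[ℝ] ℝ :=
  (basisMonomials (Fin n) ℝ).constr ℝ (diagMoment R)

lemma momentFunctional_monomial
    (R : Matrix (Fin (t + 1) → Fin n) (Fin (t + 1) → Fin n) ℂ) (γ : Fin n →₀ ℕ) (c : ℝ) :
    momentFunctional R (monomial γ c) = c * diagMoment R γ := by
  have h : monomial γ c = c • basisMonomials (Fin n) ℝ γ := by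
    simp [smul_monomial]
  rw [h, map_smul, momentFunctional, Module.Basis.constr_basis, smul_eq_mul]

/-- Write `δ = c + 2 h`. A word with exponent `h` in the registers `1, …, s` and `c + h` outside
turns the entry of `R^{T_{B[s]}}` at `δ, ε` into an entry of `R` whose row and column exponents are
both `(δ + ε) / 2`, that is, into the moment of `δ + ε`. -/
lemma sum_parityClass_nonneg (ht : 1 ≤ t)
    {R : Matrix (Fin (t + 1) → Fin n) (Fin (t + 1) → Fin n) ℂ} (hR : IsBoseSymmetric R)
    (hpos : ∀ s : ℕ, s ≤ (t + 1) / 2 → (partialTransposeFirst s R).PosSemidef)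
    (S : Finset (Fin n →₀ ℕ)) (c : Fin n →₀ ℕ)
    (hS : ∀ δ ∈ S, δ.degree = t + 1 ∧ parityExp δ = c) (y : (Fin n →₀ ℕ) → ℝ) :
    0 ≤ ∑ δ ∈ S, ∑ ε ∈ S, y δ * y ε * diagMoment R (δ + ε) := by
  -- This is the common degree of the halves `h`; the division is exact as soon as `S` is nonempty.
  set s := (t + 1 - c.degree) / 2 with hs
  have hdeg : ∀ δ ∈ S, (halfExp δ).degree = s ∧ c.degree + s = t + 1 - s := by
    intro δ hδ
    have h := congrArg Finsupp.degree (parityExp_add_two_nsmul_halfExp δ)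
    rw [map_add, map_nsmul, (hS δ hδ).1, (hS δ hδ).2, smul_eq_mul] at h
    omega
  have hword : ∀ δ : S, ∃ i : Fin (t + 1) → Fin n,
      expInside s i = halfExp δ.1 ∧ expOutside s i = c + halfExp δ.1 := fun δ =>
    exists_word_expInside_expOutside (by omega) _ _ (hdeg δ.1 δ.2).1
      (by rw [map_add, (hdeg δ.1 δ.2).1, (hdeg δ.1 δ.2).2])
  choose u hu using hword
  have hentry : ∀ δ ε : S, (partialTransposeFirst s R (u δ) (u ε)).re =
      diagMoment R (δ.1 + ε.1) := by
    intro δ ε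
    have h1 : wordExp (mixWord s (u ε) (u δ)) = wordExp (mixWord s (u δ) (u ε)) := by
      rw [wordExp_mixWord, wordExp_mixWord, (hu δ).1, (hu δ).2, (hu ε).1, (hu ε).2]
      abel
    have h2 : δ.1 + ε.1 = 2 • wordExp (mixWord s (u δ) (u ε)) := by
      have e : ∀ δ : S, c + 2 • halfExp δ.1 = δ.1 := fun δ => by
        rw [← (hS δ.1 δ.2).2, parityExp_add_two_nsmul_halfExp]
      rw [wordExp_mixWord, (hu δ).2, (hu ε).1]
      calc δ.1 + ε.1 = (c + 2 • halfExp δ.1) + (c + 2 • halfExp ε.1) := by rw [e, e]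
        _ = _ := by abel
    rw [h2, diagMoment_two_nsmul hR, partialTransposeFirst_apply, hR.apply_eq rfl h1]
  have h0 := ((hpos s (by omega)).submatrix u).dotProduct_mulVec_nonneg
    (fun δ : S => ((y δ.1 : ℝ) : ℂ))
  have h1 := (Complex.le_def.mp h0).1
  rw [Complex.zero_re] at h1
  rw [← Finset.sum_coe_sort S]
  refine h1.trans_eq ?_
  simp only [dotProduct, Matrix.mulVec, Complex.re_sum, Finset.mul_sum, Pi.star_apply,
    Matrix.submatrix_apply]
  refine Finset.sum_congr rfl fun δ _ => ?_
  rw [← Finset.sum_coe_sort S]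
  refine Finset.sum_congr rfl fun ε _ => ?_
  rw [← hentry]
  simp
  ring

/-- Moments between different parity classes vanish, so the expansion of `p * p` is a sum of block
contributions, one per class. -/
lemma momentFunctional_mul_self_nonneg (ht : 1 ≤ t)
    {R : Matrix (Fin (t + 1) → Fin n) (Fin (t + 1) → Fin n) ℂ} (hR : IsBoseSymmetric R)
    (hpos : ∀ s : ℕ, s ≤ (t + 1) / 2 → (partialTransposeFirst s R).PosSemidef)
    {p : MvPolynomial (Fin n) ℝ} (hp : p.IsHomogeneous (t + 1)) :
    0 ≤ momentFunctional R (p * p) := by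
  classical
  have hexp : momentFunctional R (p * p) = ∑ δ ∈ p.support, ∑ ε ∈ p.support,
      coeff δ p * coeff ε p * diagMoment R (δ + ε) := by
    conv_lhs => rw [p.as_sum]
    simp only [Finset.sum_mul_sum, map_sum, monomial_mul, momentFunctional_monomial]
  rw [hexp, ← Finset.sum_fiberwise_of_maps_to (g := parityExp) (t := p.support.image parityExp)
    fun δ hδ => Finset.mem_image_of_mem _ hδ]
  refine Finset.sum_nonneg fun c _ => ?_
  have h := sum_parityClass_nonneg ht hR hpos (p.support.filter fun δ => parityExp δ = c) c
    (fun δ hδ => ⟨?_, (Finset.mem_filter.mp hδ).2⟩) (fun δ => coeff δ p)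
  · refine h.trans_eq (Finset.sum_congr rfl fun δ hδ => ?_)
    refine Finset.sum_subset (Finset.filter_subset _ _) fun ε hε hε' => ?_
    rw [diagMoment_add_eq_zero, mul_zero]
    intro heq
    exact hε' (Finset.mem_filter.mpr ⟨hε, heq ▸ (Finset.mem_filter.mp hδ).2⟩)
  · rw [Finsupp.degree_eq_weight_one]
    exact hp (mem_support_iff.mp (Finset.mem_filter.mp hδ).1)

lemma momentFunctional_multQuarticForm_single (ht : 1 ≤ t)
    {R : Matrix (Fin (t + 1) → Fin n) (Fin (t + 1) → Fin n) ℂ} (hR : IsBoseSymmetric R)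
    (a b : Fin n) :
    momentFunctional R (multQuarticForm n (t - 1) (Matrix.single a b 1)) =
      (partialTraceLast R (a, b) (a, b)).re := by
  rw [multQuarticForm_single, sum_X_sq_pow, Finset.sum_mul, map_sum, partialTraceLast,
    Matrix.of_apply, Complex.re_sum]
  refine Finset.sum_congr rfl fun k _ => ?_
  rw [mul_comm, ← monomial_wordExp_concatIndex_sq ht, monomial_pow, one_pow,
    momentFunctional_monomial, one_mul, diagMoment_two_nsmul hR]

lemma mem_symmDualCone_of_mem_DPSBose (ht : 1 ≤ t) {Y : Matrix (Fin n) (Fin n) ℝ}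
    (hY : Y.IsSymm)
    (h : partialTransposeB (rhoPair Y (Y.map (fun x : ℝ => (x : ℂ)))) ∈ DPSBose n t) :
    Y ∈ symmDualCone (coneK n (t - 1)) := by
  obtain ⟨-, R, hR, hpos, hρ⟩ := h
  refine ⟨hY, fun A hA => ?_⟩
  -- Only the diagonal entries of `ρ` are needed to recover `Y`.
  have hval : ∀ a b, momentFunctional R (multQuarticForm n (t - 1) (Matrix.single a b 1)) =
      Y a b := fun a b => by
    rw [momentFunctional_multQuarticForm_single ht hR, ← hρ, partialTransposeB_rhoPair_apply,
      if_pos rfl, Complex.ofReal_re]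
  have htrace : (Y.transpose * A).trace = momentFunctional R (multQuarticForm n (t - 1) A) := by
    conv_rhs => rw [Matrix.matrix_eq_sum_single A]
    have hs : ∀ a b, Matrix.single a b (A a b) = A a b • Matrix.single a b (1 : ℝ) := fun a b => by
      rw [Matrix.smul_single, smul_eq_mul, mul_one]
    simp only [map_sum, hs, map_smul, hval, smul_eq_mul]
    rw [Finset.sum_comm]
    simp only [Matrix.trace, Matrix.diag, Matrix.mul_apply, Matrix.transpose_apply]
    exact Finset.sum_congr rfl fun _ _ => Finset.sum_congr rfl fun _ _ => mul_comm _ _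
  have hhom : (multQuarticForm n (t - 1) A).IsHomogeneous (2 * (t + 1)) := by
    have := isHomogeneous_multQuarticForm (t - 1) A
    rwa [show 2 * (t - 1) + 4 = 2 * (t + 1) by omega] at this
  -- The squares in `coneK` are of arbitrary polynomials, while positivity is known only for squares
  -- of forms of degree `t + 1`.
  obtain ⟨l, hl, hsum⟩ := IsSumSq.exists_list_isHomogeneous hA.2 hhom
  rw [htrace, multQuarticForm_apply, hsum, map_list_sum, List.map_map]
  refine List.sum_nonneg fun x hx => ?_
  obtain ⟨q, hq, rfl⟩ := List.mem_map.mp hx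
  exact momentFunctional_mul_self_nonneg ht hR hpos (hl q hq)

end Moments

theorem theorem4p6 (n t : ℕ) (ht : 1 ≤ t) (X : Matrix (Fin n) (Fin n) ℝ) (hX : X.IsSymm) :
    partialTransposeB (rhoPair X (X.map (fun x : ℝ => (x : ℂ)))) ∈ DPSBose n t ↔
      X ∈ symmDualCone (coneK n (t - 1)) :=
  ⟨mem_symmDualCone_of_mem_DPSBose ht hX, mem_DPSBose_of_mem_symmDualCone ht⟩
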